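/- Let $n\ge 2$ and $1\le k\le n$. Let $\mathrm{Gr}(m,N)$ be the Grassmannian of $m$-dimensional linear subspaces of $\mathbb{R}^N$ (empty if $m>N$) and $\mathrm{Graff}(k,n)$ the set of $k$-dimensional affine subspaces $\mathbf{A}+b$ of $\mathbb{R}^n$, where $\mathbf{A}\subseteq\mathbb{R}^n$ is a $k$-dimensional linear subspace and $b\in\mathbb{R}^n$. Both carry their standard smooth structures: for every linear isomorphism $\mathbb{R}^N\cong\mathbb{R}^m\times\mathbb{R}^{N-m}$ the graphs of linear maps $T:\mathbb{R}^m\to\mathbb{R}^{N-m}$ form a chart domain of $\mathrm{Gr}(m,N)$ with coordinate $T$, and for every linear isomorphism $\mathbb{R}^n\cong\mathbb{R}^k\times\mathbb{R}^{n-k}$ the graphs of affine maps $x\mapsto Tx+c$ form a chart domain of $\mathrm{Graff}(k,n)$ with coordinates $(T,c)$. Identify $\mathbb{R}^n$ with $\mathbb{R}^n\times\{0\}\subseteq\mathbb{R}^{n+1}$ and let $e_{n+1}=(0,\dots,0,1)^{\mathsf T}\in\mathbb{R}^{n+1}$. Then: 1. The map $$j:\mathrm{Graff}(k,n)\to\mathrm{Gr}(k+1,n+1),\qquad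 \mathbf{A}+b\mapsto\operatorname{span}\bigl(\mathbf{A}\cup\{b+e_{n+1}\}\bigr),$$ is well defined (it does not depend on the choice of $b$), and it is a smooth embedding with open image and a diffeomorphism onto that image, so that $\mathrm{Graff}(k,n)$ is an open submanifold of $\mathrm{Gr}(k+1,n+1)$. 2. The complement of the image of $j$ is the set of $(k+1)$-dimensional subspaces of $\mathbb{R}^{n+1}$ contained in $\mathbb{R}^n$, i.e. the image of the natural map $\mathrm{Gr}(k+1,n)\to\mathrm{Gr}(k+1,n+1)$. This map is a smooth embedding, and its image has codimension $k+1\ge 2$ at each of its points. 3. The complement of the image of $j$ has measure zero with respect to the orthogonally invariant Radon probability measure on $\mathrm{Gr}(k+1,n+1)$, i.e. the image of the normalized Haar measure of the orthogonal group $\mathrm{O}(n+1)$ under $g\mapsto g\,\mathbb{R}^{k+1}$. -/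

import Mathlib

open Set Module
open scoped Manifold ContDiff

noncomputable section

namespace AffGr

/-! ### Smooth structures given by a family of parametrizations -/

section Core

variable {ι E M : Type*} [NormedAddCommGroup E] [NormedSpace ℝ E]

/-- The chart inverse to an injective parametrization `p : E → M`, defined on the range of `p`. -/
def chartOf (p : E → M) (hp : Function.Injective p) : PartialEquiv M E where
  toFun := Function.invFun p
  invFun := p
  source := range p
  target := univ
  map_source' := fun _ _ => mem_univ _
  map_target' := fun a _ => mem_range_self a
  left_inv' := fun _ hx => Function.invFun_eq hx
  right_inv' := fun a _ => Function.leftInverse_invFun hp a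

/-- A family of injective parametrizations `p i : E → M` that covers `M` and has smooth coordinate
changes with open domains: the data of a smooth atlas on the set `M`. -/
structure IsSmoothParam (p : ι → E → M) : Prop where
  inj : ∀ i, Function.Injective (p i)
  cover : ∀ x, ∃ i, x ∈ range (p i)
  isOpen_dom : ∀ i j, IsOpen {a | p i a ∈ range (p j)}
  contDiffOn : ∀ i j,
    ContDiffOn ℝ ∞ (fun a => Function.invFun (p j) (p i a)) {a | p i a ∈ range (p j)}

variable {p : ι → E → M}

/-- The atlas formed by the charts inverse to the parametrizations. -/
def IsSmoothParam.core (h : IsSmoothParam p) : ChartedSpaceCore E M where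
  atlas := range fun i => chartOf (p i) (h.inj i)
  chartAt := fun x => chartOf (p (h.cover x).choose) (h.inj _)
  mem_chart_source := fun x => (h.cover x).choose_spec
  chart_mem_atlas := fun x => mem_range_self _
  open_source := by
    rintro _ _ ⟨i, rfl⟩ ⟨j, rfl⟩
    have := h.isOpen_dom i j
    rw [PartialEquiv.trans_source]
    simpa [chartOf, preimage] using this
  continuousOn_toFun := by
    rintro _ _ ⟨i, rfl⟩ ⟨j, rfl⟩
    have := (h.contDiffOn i j).continuousOn
    rw [PartialEquiv.trans_source]
    simpa [chartOf, preimage, Function.comp_def] using this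

theorem IsSmoothParam.isManifold (h : IsSmoothParam p) :
    letI := h.core.toTopologicalSpace
    letI := h.core.toChartedSpace
    IsManifold 𝓘(ℝ, E) ∞ M := by
  let _ := h.core.toTopologicalSpace
  let _ := h.core.toChartedSpace
  apply isManifold_of_contDiffOn
  intro e e' he he'
  obtain ⟨_, he⟩ := mem_iUnion.1 he
  obtain ⟨⟨i, rfl⟩, he⟩ := mem_iUnion.1 he
  obtain ⟨_, he'⟩ := mem_iUnion.1 he'
  obtain ⟨⟨j, rfl⟩, he'⟩ := mem_iUnion.1 he'
  obtain rfl := mem_singleton_iff.1 he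
  obtain rfl := mem_singleton_iff.1 he'
  refine (h.contDiffOn i j).congr_mono (fun a _ => rfl) ?_
  rintro a ⟨ha, -⟩
  exact ha.2

end Core

/-! ### Graphs with respect to a splitting `V ≃ F × G` -/

section Graph

variable {V F G : Type*} [NormedAddCommGroup V] [NormedSpace ℝ V]
  [NormedAddCommGroup F] [NormedSpace ℝ F] [NormedAddCommGroup G] [NormedSpace ℝ G]

/-- The linear subspace of `V` which is the graph of `T : F → G` in the coordinates `e`. -/
def graphSub (e : V ≃L[ℝ] F × G) (T : F →L[ℝ] G) : Submodule ℝ V where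
  carrier := {v | (e v).2 = T (e v).1}
  add_mem' := by
    intro a b ha hb
    simp_all
  zero_mem' := by simp
  smul_mem' := by
    intro c a ha
    simp_all

/-- The affine subspace of `V` which is the graph of `x ↦ T x + c` in the coordinates `e`. -/
def graphAff (e : V ≃L[ℝ] F × G) (a : (F →L[ℝ] G) × G) : AffineSubspace ℝ V where
  carrier := {v | (e v).2 = a.1 (e v).1 + a.2}
  smul_vsub_vadd_mem' := by
    intro c x y z hx hy hz
    simp only [mem_ofPred_eq, vsub_eq_sub, vadd_eq_add, map_add, map_smul, map_sub, Prod.snd_add,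
      Prod.smul_snd, Prod.snd_sub, Prod.fst_add, Prod.smul_fst, Prod.fst_sub] at *
    rw [hx, hy, hz]
    simp only [smul_sub, smul_add]
    abel

theorem mem_graphSub {e : V ≃L[ℝ] F × G} {T : F →L[ℝ] G} {v : V} :
    v ∈ graphSub e T ↔ (e v).2 = T (e v).1 := Iff.rfl

theorem mem_graphAff {e : V ≃L[ℝ] F × G} {a : (F →L[ℝ] G) × G} {v : V} :
    v ∈ graphAff e a ↔ (e v).2 = a.1 (e v).1 + a.2 := Iff.rfl

theorem graphAff_nonempty (e : V ≃L[ℝ] F × G) (a : (F →L[ℝ] G) × G) :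
    (graphAff e a : Set V).Nonempty :=
  ⟨e.symm (0, a.2), by simp [mem_graphAff]⟩

theorem graphAff_direction (e : V ≃L[ℝ] F × G) (a : (F →L[ℝ] G) × G) :
    (graphAff e a).direction = graphSub e a.1 := by
  have h0 : e.symm (0, a.2) ∈ graphAff e a := by simp [mem_graphAff]
  ext v
  rw [← AffineSubspace.vadd_mem_iff_mem_direction v h0, mem_graphAff, mem_graphSub]
  simp

theorem finrank_graphSub (e : V ≃L[ℝ] F × G) (T : F →L[ℝ] G) :
    finrank ℝ (graphSub e T) = finrank ℝ F := by
  refine LinearEquiv.finrank_eq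
    (LinearEquiv.ofBijective ((LinearMap.fst ℝ F G ∘ₗ e.toLinearMap).domRestrict _) ⟨?_, ?_⟩)
  · rintro ⟨v, hv⟩ ⟨w, hw⟩ h
    rw [mem_graphSub] at hv hw
    have h1 : (e v).1 = (e w).1 := h
    exact Subtype.ext (e.injective (Prod.ext h1 (by rw [hv, hw, h1])))
  · intro x
    exact ⟨⟨e.symm (x, T x), by simp [mem_graphSub]⟩, by simp⟩

/-- The first component of the coordinate change `e' ∘ e⁻¹` along the graph of `T`. -/
def transP (e e' : V ≃L[ℝ] F × G) (T : F →L[ℝ] G) : F →L[ℝ] F :=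
  (ContinuousLinearMap.fst ℝ F G ∘L (e.symm.trans e' : F × G →L[ℝ] F × G)) ∘L
      ContinuousLinearMap.inl ℝ F G +
    ((ContinuousLinearMap.fst ℝ F G ∘L (e.symm.trans e' : F × G →L[ℝ] F × G)) ∘L
      ContinuousLinearMap.inr ℝ F G) ∘L T

/-- The second component of the coordinate change `e' ∘ e⁻¹` along the graph of `T`. -/
def transQ (e e' : V ≃L[ℝ] F × G) (T : F →L[ℝ] G) : F →L[ℝ] G :=
  (ContinuousLinearMap.snd ℝ F G ∘L (e.symm.trans e' : F × G →L[ℝ] F × G)) ∘L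
      ContinuousLinearMap.inl ℝ F G +
    ((ContinuousLinearMap.snd ℝ F G ∘L (e.symm.trans e' : F × G →L[ℝ] F × G)) ∘L
      ContinuousLinearMap.inr ℝ F G) ∘L T

theorem transP_apply (e e' : V ≃L[ℝ] F × G) (T : F →L[ℝ] G) (x : F) :
    transP e e' T x = (e' (e.symm (x, T x))).1 := by
  have : (x, T x) = (x, (0 : G)) + ((0 : F), T x) := by simp
  rw [this, map_add, map_add]
  simp [transP]

theorem transQ_apply (e e' : V ≃L[ℝ] F × G) (T : F →L[ℝ] G) (x : F) :
    transQ e e' T x = (e' (e.symm (x, T x))).2 := by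
  have : (x, T x) = (x, (0 : G)) + ((0 : F), T x) := by simp
  rw [this, map_add, map_add]
  simp [transQ]

theorem contDiff_transP (e e' : V ≃L[ℝ] F × G) : ContDiff ℝ ∞ (transP e e') :=
  contDiff_const.add (contDiff_const.clm_comp contDiff_id)

theorem contDiff_transQ (e e' : V ≃L[ℝ] F × G) : ContDiff ℝ ∞ (transQ e e') :=
  contDiff_const.add (contDiff_const.clm_comp contDiff_id)

/-- The coordinate change for graphs of linear maps. -/
def trans (e e' : V ≃L[ℝ] F × G) (T : F →L[ℝ] G) : F →L[ℝ] G :=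
  transQ e e' T ∘L Ring.inverse (transP e e' T)

theorem contDiffOn_trans [CompleteSpace F] (e e' : V ≃L[ℝ] F × G) :
    ContDiffOn ℝ ∞ (trans e e') {T | IsUnit (transP e e' T)} := by
  refine (contDiff_transQ e e').contDiffOn.clm_comp ?_
  rintro T ⟨u, hu⟩
  have h1 : ContDiffAt ℝ ∞ Ring.inverse (transP e e' T) := hu ▸ contDiffAt_ringInverse ℝ u
  exact (h1.comp T (contDiff_transP e e').contDiffAt).contDiffWithinAt

theorem isOpen_isUnit_transP [CompleteSpace F] (e e' : V ≃L[ℝ] F × G) :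
    IsOpen {T | IsUnit (transP e e' T)} :=
  Units.isOpen.preimage (contDiff_transP e e').continuous

theorem isUnit_transP [FiniteDimensional ℝ F] {e e' : V ≃L[ℝ] F × G} {T T' : F →L[ℝ] G}
    (h : graphSub e T = graphSub e' T') : IsUnit (transP e e' T) := by
  have : CompleteSpace F := FiniteDimensional.complete ℝ F
  rw [ContinuousLinearMap.isUnit_iff_bijective]
  have hinj : Function.Injective (transP e e' T) := by
    rw [injective_iff_map_eq_zero]
    intro x hx
    have h1 : e.symm (x, T x) ∈ graphSub e' T' := h ▸ (by simp [mem_graphSub])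
    rw [mem_graphSub, ← transP_apply, hx, map_zero] at h1
    have h2 : e' (e.symm (x, T x)) = 0 := Prod.ext (by rw [← transP_apply, hx]; rfl) h1
    simp only [map_eq_zero_iff _ e'.injective, map_eq_zero_iff _ e.symm.injective] at h2
    exact congrArg Prod.fst h2
  exact ⟨hinj, LinearMap.surjective_of_injective (f := (transP e e' T).toLinearMap) hinj⟩

theorem graphAff_trans {e e' : V ≃L[ℝ] F × G} {T : F →L[ℝ] G}
    (h : IsUnit (transP e e' T)) (c : G) :
    graphAff e' (trans e e' T, (e' (e.symm (0, c))).2 - trans e e' T (e' (e.symm (0, c))).1) =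
      graphAff e (T, c) := by
  set P := transP e e' T with hP
  have hr : ∀ x, Ring.inverse P (P x) = x := fun x =>
    DFunLike.congr_fun (Ring.inverse_mul_cancel P h) x
  have hl : ∀ x, P (Ring.inverse P x) = x := fun x =>
    DFunLike.congr_fun (Ring.mul_inverse_cancel P h) x
  have hT : ∀ x, trans e e' T (P x) = transQ e e' T x := fun x => by
    simp only [trans, ContinuousLinearMap.comp_apply, ← hP, hr]
  have key : ∀ x, e' (e.symm (x, T x + c)) =
      (P x + (e' (e.symm (0, c))).1, transQ e e' T x + (e' (e.symm (0, c))).2) := fun x => by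
    have : (x, T x + c) = (x, T x) + ((0 : F), c) := by simp
    rw [this, map_add, map_add, hP]
    exact Prod.ext (by simp [transP_apply]) (by simp [transQ_apply])
  ext v
  rw [mem_graphAff, mem_graphAff]
  constructor
  · intro hv
    set x := Ring.inverse P ((e' v).1 - (e' (e.symm (0, c))).1) with hx
    have h2 : e' (e.symm (x, T x + c)) = e' v := by
      rw [key]
      refine Prod.ext ?_ ?_
      · simp [hx, hl]
      · rw [hv, ← hT, hx, hl, map_sub]
        simp only
        abel
    have h3 : v = e.symm (x, T x + c) := (e'.injective h2).symm
    rw [h3]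
    simp
  · intro hv
    have h3 : v = e.symm ((e v).1, T (e v).1 + c) := by
      rw [← hv]; simp
    rw [h3, key]
    simp only [map_add, hT]
    abel

theorem graphSub_trans {e e' : V ≃L[ℝ] F × G} {T : F →L[ℝ] G}
    (h : IsUnit (transP e e' T)) : graphSub e' (trans e e' T) = graphSub e T := by
  have := congrArg AffineSubspace.direction (graphAff_trans h 0)
  rwa [graphAff_direction, graphAff_direction] at this

theorem graphSub_injective (e : V ≃L[ℝ] F × G) : Function.Injective (graphSub e) := by
  intro T T' h
  ext x
  have h1 : e.symm (x, T x) ∈ graphSub e T' := h ▸ (by simp [mem_graphSub])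
  simpa [mem_graphSub] using h1

theorem graphAff_injective (e : V ≃L[ℝ] F × G) : Function.Injective (graphAff e) := by
  rintro ⟨T, c⟩ ⟨T', c'⟩ h
  have h1 := congrArg AffineSubspace.direction h
  rw [graphAff_direction, graphAff_direction] at h1
  have h2 : T = T' := graphSub_injective e h1
  subst h2
  have h3 : e.symm (0, c) ∈ graphAff e (T, c') := h ▸ (by simp [mem_graphAff])
  simpa [mem_graphAff] using h3

end Graph

/-! ### The Grassmannian -/

/-- The Grassmannian of `k`-dimensional linear subspaces of `ℝⁿ`. -/
def Gr (k n : ℕ) : Type := {U : Submodule ℝ (Fin n → ℝ) // finrank ℝ U = k}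

/-- The Grassmannian of `k`-flats, i.e. (nonempty) `k`-dimensional affine subspaces of `ℝⁿ`. -/
def Graff (k n : ℕ) : Type :=
  {S : AffineSubspace ℝ (Fin n → ℝ) // (S : Set (Fin n → ℝ)).Nonempty ∧
    finrank ℝ S.direction = k}

/-- Linear coordinates on `ℝⁿ` that split it as `ℝᵏ × ℝⁿ⁻ᵏ`. -/
abbrev Splitting (k n : ℕ) : Type := (Fin n → ℝ) ≃L[ℝ] (Fin k → ℝ) × (Fin (n - k) → ℝ)

/-- The model space of `Gr k n`. -/
abbrev GrModel (k n : ℕ) : Type := (Fin k → ℝ) →L[ℝ] (Fin (n - k) → ℝ)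

/-- The model space of `Graff k n`. -/
abbrev GraffModel (k n : ℕ) : Type :=
  ((Fin k → ℝ) →L[ℝ] (Fin (n - k) → ℝ)) × (Fin (n - k) → ℝ)

theorem exists_splitting {k n : ℕ} (U : Submodule ℝ (Fin n → ℝ)) (hU : finrank ℝ U = k) :
    ∃ e : Splitting k n, graphSub e 0 = U := by
  obtain ⟨W, hW⟩ := U.exists_isCompl
  have hdim : finrank ℝ W = n - k := by
    have := Submodule.finrank_add_eq_of_isCompl hW
    rw [hU, finrank_fin_fun] at this
    omega
  let f : U ≃ₗ[ℝ] (Fin k → ℝ) := LinearEquiv.ofFinrankEq _ _ (by simp [hU])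
  let g : W ≃ₗ[ℝ] (Fin (n - k) → ℝ) := LinearEquiv.ofFinrankEq _ _ (by simp [hdim])
  let e := (Submodule.prodEquivOfIsCompl U W hW).symm.trans (f.prodCongr g)
  refine ⟨e.toContinuousLinearEquiv, ?_⟩
  ext v
  rw [mem_graphSub]
  change g ((Submodule.prodEquivOfIsCompl U W hW).symm v).2 = 0 ↔ _
  rw [map_eq_zero_iff g g.injective, Submodule.prodEquivOfIsCompl_symm_apply_snd_eq_zero]

/-- The parametrization `T ↦ graph of T` of an open piece of the Grassmannian. -/
def Gr.param {k n : ℕ} (e : Splitting k n) (T : GrModel k n) : Gr k n :=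
  ⟨graphSub e T, by rw [finrank_graphSub, finrank_fin_fun]⟩

/-- The parametrization `(T, c) ↦ graph of x ↦ T x + c` of an open piece of the affine
Grassmannian. -/
def Graff.param {k n : ℕ} (e : Splitting k n) (a : GraffModel k n) : Graff k n :=
  ⟨graphAff e a, graphAff_nonempty e a, by
    rw [graphAff_direction, finrank_graphSub, finrank_fin_fun]⟩

theorem Gr.param_mem_range {k n : ℕ} (e e' : Splitting k n) :
    {T | Gr.param e T ∈ range (Gr.param e')} = {T | IsUnit (transP e e' T)} := by
  ext T
  constructor
  · rintro ⟨T', h⟩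
    exact isUnit_transP (congrArg Subtype.val h).symm
  · intro h
    exact ⟨_, Subtype.ext (graphSub_trans h)⟩

theorem Graff.param_mem_range {k n : ℕ} (e e' : Splitting k n) :
    {a | Graff.param e a ∈ range (Graff.param e')} = {a | IsUnit (transP e e' a.1)} := by
  ext a
  constructor
  · rintro ⟨a', h⟩
    have := congrArg (fun S : Graff k n => S.1.direction) h
    simp only [Graff.param, graphAff_direction] at this
    exact isUnit_transP this.symm
  · intro h
    exact ⟨_, Subtype.ext (graphAff_trans h a.2)⟩

theorem Gr.isSmoothParam (k n : ℕ) : IsSmoothParam (Gr.param (k := k) (n := n)) where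
  inj := fun e T T' h => graphSub_injective e (congrArg Subtype.val h)
  cover := fun U => by
    obtain ⟨e, he⟩ := exists_splitting U.1 U.2
    exact ⟨e, 0, Subtype.ext he⟩
  isOpen_dom := fun e e' => by
    rw [Gr.param_mem_range]
    exact isOpen_isUnit_transP e e'
  contDiffOn := fun e e' => by
    rw [Gr.param_mem_range]
    refine (contDiffOn_trans e e').congr fun T hT => ?_
    have h : Gr.param e T = Gr.param e' (trans e e' T) := Subtype.ext (graphSub_trans hT).symm
    rw [h]
    exact Function.leftInverse_invFun
      (fun T T' h => graphSub_injective e' (congrArg Subtype.val h)) _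

theorem Graff.isSmoothParam (k n : ℕ) : IsSmoothParam (Graff.param (k := k) (n := n)) where
  inj := fun e T T' h => graphAff_injective e (congrArg Subtype.val h)
  cover := fun S => by
    obtain ⟨e, he⟩ := exists_splitting S.1.direction S.2.2
    obtain ⟨p, hp⟩ := S.2.1
    refine ⟨e, (0, (e p).2), Subtype.ext ?_⟩
    refine AffineSubspace.ext_of_direction_eq ?_ ⟨p, ?_, hp⟩
    · simp only [Graff.param, graphAff_direction, he]
    · change p ∈ graphAff e _
      simp [mem_graphAff]
  isOpen_dom := fun e e' => by
    rw [Graff.param_mem_range]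
    exact (isOpen_isUnit_transP e e').preimage continuous_fst
  contDiffOn := fun e e' => by
    rw [Graff.param_mem_range]
    have h1 : ContDiffOn ℝ ∞ (fun a : GraffModel k n => trans e e' a.1)
        {a | IsUnit (transP e e' a.1)} :=
      (contDiffOn_trans e e').comp contDiff_fst.contDiffOn fun _ h => h
    have h2 : ContDiff ℝ ∞ (fun a : GraffModel k n => e' (e.symm (0, a.2))) :=
      e'.contDiff.comp (e.symm.contDiff.comp (contDiff_const.prodMk contDiff_snd))
    refine (h1.prodMk ((contDiff_snd.comp h2).contDiffOn.sub
      (h1.clm_apply (contDiff_fst.comp h2).contDiffOn))).congr fun a ha => ?_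
    have h : Graff.param e a = Graff.param e' _ := Subtype.ext (graphAff_trans ha a.2).symm
    rw [h]
    exact Function.leftInverse_invFun
      (fun T T' h => graphAff_injective e' (congrArg Subtype.val h)) _

instance (k n : ℕ) : TopologicalSpace (Gr k n) := (Gr.isSmoothParam k n).core.toTopologicalSpace

instance (k n : ℕ) : ChartedSpace (GrModel k n) (Gr k n) :=
  (Gr.isSmoothParam k n).core.toChartedSpace

instance (k n : ℕ) : IsManifold 𝓘(ℝ, GrModel k n) ∞ (Gr k n) := (Gr.isSmoothParam k n).isManifold

instance (k n : ℕ) : TopologicalSpace (Graff k n) :=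
  (Graff.isSmoothParam k n).core.toTopologicalSpace

instance (k n : ℕ) : ChartedSpace (GraffModel k n) (Graff k n) :=
  (Graff.isSmoothParam k n).core.toChartedSpace

instance (k n : ℕ) : IsManifold 𝓘(ℝ, GraffModel k n) ∞ (Graff k n) :=
  (Graff.isSmoothParam k n).isManifold

/-! ### The invariant measure on the Grassmannian -/

instance (k n : ℕ) : MeasurableSpace (Gr k n) := borel _

instance (k n : ℕ) : BorelSpace (Gr k n) := ⟨rfl⟩

instance (n : ℕ) : MeasurableSpace (Matrix.orthogonalGroup (Fin n) ℝ) := borel _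

instance (n : ℕ) : BorelSpace (Matrix.orthogonalGroup (Fin n) ℝ) := ⟨rfl⟩

instance (n : ℕ) : CompactSpace (Matrix.orthogonalGroup (Fin n) ℝ) := by
  refine isCompact_iff_compactSpace.1
    (?_ : IsCompact (Matrix.orthogonalGroup (Fin n) ℝ : Set (Matrix (Fin n) (Fin n) ℝ)))
  have hK : IsCompact (univ.pi fun _ : Fin n => univ.pi fun _ : Fin n => Icc (-1 : ℝ) 1) :=
    isCompact_univ_pi fun _ => isCompact_univ_pi fun _ => isCompact_Icc
  refine hK.of_isClosed_subset ?_ ?_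
  · have : ((Matrix.orthogonalGroup (Fin n) ℝ : Set (Matrix (Fin n) (Fin n) ℝ))) =
        {A : Matrix (Fin n) (Fin n) ℝ | A * star A = 1} := by
      ext A
      exact Matrix.mem_unitaryGroup_iff
    rw [this]
    exact isClosed_eq (continuous_id.matrix_mul continuous_star) continuous_const
  · intro A hA i _ j _
    exact abs_le.1 (entry_norm_bound_of_unitary hA i j)

/-- The image `g U` of a `k`-dimensional subspace under an orthogonal transformation. -/
def Gr.act {k n : ℕ} (g : Matrix.orthogonalGroup (Fin n) ℝ) (U : Gr k n) : Gr k n :=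
  ⟨U.1.map (Matrix.toLin' g.1),
    (LinearEquiv.finrank_map_eq (Matrix.UnitaryGroup.toLinearEquiv g) U.1).trans U.2⟩

theorem Gr.continuous_param {k n : ℕ} (e : Splitting k n) : Continuous (Gr.param e) := by
  have h := ((Gr.isSmoothParam k n).core.openPartialHomeomorph _
    (mem_range_self (f := fun i => chartOf (Gr.param i) ((Gr.isSmoothParam k n).inj i))
      e)).continuousOn_symm
  exact continuousOn_univ.1 h

theorem Gr.continuous_act {k n : ℕ} (U : Gr k n) :
    Continuous fun g : Matrix.orthogonalGroup (Fin n) ℝ => Gr.act g U := by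
  obtain ⟨e₀, he₀⟩ := exists_splitting U.1 U.2
  let L (g : Matrix.orthogonalGroup (Fin n) ℝ) : (Fin n → ℝ) ≃L[ℝ] (Fin n → ℝ) :=
    (Matrix.UnitaryGroup.toLinearEquiv g).toContinuousLinearEquiv
  let M : Matrix (Fin n) (Fin n) ℝ →ₗ[ℝ] ((Fin n → ℝ) →L[ℝ] (Fin n → ℝ)) :=
    LinearMap.toContinuousLinearMap.toLinearMap ∘ₗ Matrix.toLin'.toLinearMap
  have hM : Continuous fun g : Matrix.orthogonalGroup (Fin n) ℝ => M g.1 :=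
    M.continuous_of_finiteDimensional.comp continuous_subtype_val
  have hact : ∀ g, (Gr.act g U).1 = graphSub ((L g).symm.trans e₀) 0 := by
    intro g
    have h : (Gr.act g U).1 = U.1.map (Matrix.UnitaryGroup.toLinearEquiv g).toLinearMap := rfl
    rw [h, ← he₀]
    ext v
    rw [Submodule.mem_map_equiv]
    rfl
  have hP : ∀ e : Splitting k n, Continuous fun g => transP ((L g).symm.trans e₀) e 0 := by
    intro e
    have : ∀ g, transP ((L g).symm.trans e₀) e 0 =
        (ContinuousLinearMap.fst ℝ _ _ ∘L (e : (Fin n → ℝ) →L[ℝ] (Fin k → ℝ) × (Fin (n - k) → ℝ))) ∘L M g.1 ∘L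
          ((e₀.symm : (Fin k → ℝ) × (Fin (n - k) → ℝ) →L[ℝ] (Fin n → ℝ)) ∘L
            ContinuousLinearMap.inl ℝ _ _) := by
      intro g
      ext1 x
      rw [transP_apply]
      rfl
    simp only [this]
    exact continuous_const.clm_comp (hM.clm_comp continuous_const)
  have hQ : ∀ e : Splitting k n, Continuous fun g => transQ ((L g).symm.trans e₀) e 0 := by
    intro e
    have : ∀ g, transQ ((L g).symm.trans e₀) e 0 =
        (ContinuousLinearMap.snd ℝ _ _ ∘L (e : (Fin n → ℝ) →L[ℝ] (Fin k → ℝ) × (Fin (n - k) → ℝ))) ∘L M g.1 ∘L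
          ((e₀.symm : (Fin k → ℝ) × (Fin (n - k) → ℝ) →L[ℝ] (Fin n → ℝ)) ∘L
            ContinuousLinearMap.inl ℝ _ _) := by
      intro g
      ext1 x
      rw [transQ_apply]
      rfl
    simp only [this]
    exact continuous_const.clm_comp (hM.clm_comp continuous_const)
  rw [continuous_iff_continuousAt]
  intro g₀
  obtain ⟨e, he⟩ := exists_splitting (Gr.act g₀ U).1 (Gr.act g₀ U).2
  have hu : IsUnit (transP ((L g₀).symm.trans e₀) e 0) :=
    isUnit_transP (T' := 0) ((hact g₀).symm.trans he.symm)
  have hev : ∀ᶠ g in nhds g₀, IsUnit (transP ((L g).symm.trans e₀) e 0) :=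
    (Units.isOpen.preimage (hP e)).mem_nhds hu
  have hc : ContinuousAt (fun g => Gr.param e (trans ((L g).symm.trans e₀) e 0)) g₀ := by
    refine (Gr.continuous_param e).continuousAt.comp ?_
    refine (hQ e).continuousAt.clm_comp ?_
    obtain ⟨u, hu⟩ := hu
    have h1 : ContinuousAt Ring.inverse (transP ((L g₀).symm.trans e₀) e 0) :=
      hu ▸ NormedRing.inverse_continuousAt u
    exact ContinuousAt.comp (f := fun g => transP ((L g).symm.trans e₀) e 0) h1 (hP e).continuousAt
  refine hc.congr ?_
  filter_upwards [hev] with g hg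
  exact Subtype.ext ((graphSub_trans hg).trans (hact g).symm)

/-- The coordinate plane `ℝᵏ ⊆ ℝⁿ` spanned by the first `k` standard basis vectors. -/
def Gr.base {k n : ℕ} (h : k ≤ n) : Gr k n :=
  ⟨Submodule.span ℝ (range fun i : Fin k => (Pi.single (Fin.castLE h i) 1 : Fin n → ℝ)), by
    have hli : LinearIndependent ℝ
        fun i : Fin k => (Pi.single (Fin.castLE h i) 1 : Fin n → ℝ) := by
      have := (Pi.basisFun ℝ (Fin n)).linearIndependent.comp _ (Fin.castLE_injective h)
      simpa [Function.comp_def] using this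
    rw [finrank_span_eq_card hli, Fintype.card_fin]⟩

/-- The orthogonally invariant Radon probability measure on `Gr k n`: the image of the normalized
Haar measure of the orthogonal group under `g ↦ g ℝᵏ`. -/
def Gr.measure {k n : ℕ} (h : k ≤ n) : MeasureTheory.Measure (Gr k n) :=
  MeasureTheory.Measure.map
    (fun g : Matrix.orthogonalGroup (Fin n) ℝ => Gr.act g (Gr.base h))
    (MeasureTheory.Measure.haarMeasure ⊤)

instance {k n : ℕ} (h : k ≤ n) : MeasureTheory.IsProbabilityMeasure (Gr.measure h) := by
  have : MeasureTheory.IsProbabilityMeasure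
      (MeasureTheory.Measure.haarMeasure
        (⊤ : TopologicalSpace.PositiveCompacts (Matrix.orthogonalGroup (Fin n) ℝ))) :=
    ⟨MeasureTheory.Measure.haarMeasure_self⟩
  exact MeasureTheory.Measure.isProbabilityMeasure_map
    (Gr.continuous_act (Gr.base h)).measurable.aemeasurable

/-! ### The maps between Grassmannians -/

/-- The inclusion `ℝⁿ → ℝⁿ⁺¹`, `(x₁, …, xₙ) ↦ (x₁, …, xₙ, 0)`. -/
def incl (n : ℕ) : (Fin n → ℝ) →ₗ[ℝ] (Fin (n + 1) → ℝ) where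
  toFun v := Fin.snoc (α := fun _ => ℝ) v 0
  map_add' v w := by
    ext i
    refine Fin.lastCases ?_ (fun i => ?_) i <;> simp
  map_smul' c v := by
    ext i
    refine Fin.lastCases ?_ (fun i => ?_) i <;> simp

theorem incl_last {n : ℕ} (v : Fin n → ℝ) : incl n v (Fin.last n) = 0 := by
  simp [incl]

theorem incl_injective (n : ℕ) : Function.Injective (incl n) := by
  intro v w h
  ext i
  simpa [incl] using congrFun h i.castSucc

/-- The last standard basis vector `eₙ₊₁` of `ℝⁿ⁺¹`. -/
def eLast (n : ℕ) : Fin (n + 1) → ℝ := Pi.single (Fin.last n) 1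

/-- The inclusion `Gr(k, n) → Gr(k, n + 1)` induced by `ℝⁿ ⊆ ℝⁿ⁺¹`. -/
def Gr.incl {k n : ℕ} (U : Gr k n) : Gr k (n + 1) :=
  ⟨U.1.map (AffGr.incl n),
    (Submodule.equivMapOfInjective _ (incl_injective n) U.1).finrank_eq.symm.trans U.2⟩

/-- The subspace `span (A ∪ {b + eₙ₊₁})` of `ℝⁿ⁺¹`. -/
def liftSpan {n : ℕ} (A : Submodule ℝ (Fin n → ℝ)) (b : Fin n → ℝ) :
    Submodule ℝ (Fin (n + 1) → ℝ) :=
  Submodule.span ℝ (incl n '' A ∪ {incl n b + eLast n})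

theorem liftSpan_eq {n : ℕ} (A : Submodule ℝ (Fin n → ℝ)) (b : Fin n → ℝ) :
    liftSpan A b = A.map (incl n) ⊔ Submodule.span ℝ {incl n b + eLast n} := by
  rw [liftSpan, Submodule.span_union, ← Submodule.map_coe, Submodule.span_eq]

theorem finrank_liftSpan {n : ℕ} (A : Submodule ℝ (Fin n → ℝ)) (b : Fin n → ℝ) :
    finrank ℝ (liftSpan A b) = finrank ℝ A + 1 := by
  have hnot : incl n b + eLast n ∉ A.map (incl n) := by
    rintro ⟨a, -, ha⟩
    have := congrFun ha (Fin.last n)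
    simp [incl_last, eLast] at this
  rw [liftSpan_eq, Submodule.finrank_sup_span_singleton hnot,
    (Submodule.equivMapOfInjective _ (incl_injective n) A).finrank_eq.symm]

theorem liftSpan_congr {n : ℕ} (A : Submodule ℝ (Fin n → ℝ)) {b b' : Fin n → ℝ}
    (h : b - b' ∈ A) : liftSpan A b = liftSpan A b' := by
  have key : ∀ c c' : Fin n → ℝ, c - c' ∈ A → liftSpan A c ≤ liftSpan A c' := by
    intro c c' hc
    rw [liftSpan, Submodule.span_le]
    rintro x (hx | rfl)
    · exact Submodule.subset_span (Or.inl hx)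
    · have : incl n c + eLast n = incl n (c - c') + (incl n c' + eLast n) := by
        rw [map_sub]; abel
      rw [this]
      exact add_mem (Submodule.subset_span (Or.inl ⟨_, hc, rfl⟩))
        (Submodule.subset_span (Or.inr rfl))
  exact le_antisymm (key _ _ h) (key _ _ (by simpa using neg_mem h))

/-- The map `j : Graff(k, n) → Gr(k + 1, n + 1)`, `A + b ↦ span (A ∪ {b + eₙ₊₁})`. -/
def Graff.j {k n : ℕ} (S : Graff k n) : Gr (k + 1) (n + 1) :=
  ⟨liftSpan S.1.direction S.2.1.some, by rw [finrank_liftSpan, S.2.2]⟩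

/-- The value of `j` does not depend on the displacement vector. -/
theorem Graff.j_eq {k n : ℕ} (S : Graff k n) {b : Fin n → ℝ} (hb : b ∈ S.1) :
    S.j.1 = liftSpan S.1.direction b :=
  liftSpan_congr _ (AffineSubspace.vsub_mem_direction S.2.1.some_mem hb)

end AffGr

end

noncomputable section

namespace AffGr

/-! Everything smooth reduces to linear algebra in graph coordinates. Let a splitting `e` exhibit a
flat as the graph of `x ↦ T x + c`. Then `j` sends it to the graph of the homogenization `(x, t) ↦ T
x + t c` over `ℝᵏ × ℝ`, and passing from `(T, c)` to this map is a linear isomorphism. The inclusion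
induced by `ℝⁿ ⊆ ℝⁿ⁺¹` sends the graph of `T` to the graph of `(T, 0)`, a linear injection with
complement the functionals on `ℝᵏ`. The predicate `IsLinearInChartsAt` captures both situations. It
yields a smooth local left inverse (`exists_leftInverse`), hence a smooth embedding with injective
differential, and a local diffeomorphism when the complement is trivial. The source chart is
required to fill the whole preimage of the target chart, so that local information also gives
injectivity and the embedding topology.

For the complement of the image, a subspace with a vector of nonzero last coordinate meets the
hyperplane of height one in a flat, whose lift is the given subspace (`range_j_compl`). The
codimension is the difference of the dimensions of two spaces of linear maps.

For the measure, `g ℝᵏ⁺¹ ⊆ ℝⁿ` forces one entry of `g` to vanish. By invariance, this event has the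
same probability as the vanishing of any fixed nonzero combination of the entries in that column.
Along the vectors `(1, t, t², …)` a given column satisfies this for only finitely many `t`, so
Fubini makes the probability zero (`haarMeasure_entry_eq_zero`). -/

/-! ### Maps that are linear embeddings in suitable charts -/

section LinearInCharts

variable {E E' M N : Type*} [NormedAddCommGroup E] [NormedSpace ℝ E]
  [NormedAddCommGroup E'] [NormedSpace ℝ E']
  [TopologicalSpace M] [ChartedSpace E M] [TopologicalSpace N] [ChartedSpace E' N]

variable (E E') in
/-- The map `f` is `a ↦ L (a, 0)`, for a linear isomorphism `L : E × C ≃ E'`, in a smooth chart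
around `x` onto the whole model space and a smooth chart around `f x`; the domain of the first chart
is the whole preimage of the domain of the second. -/
def IsLinearInChartsAt (C : Type*) [NormedAddCommGroup C] [NormedSpace ℝ C] (f : M → N) (x : M) :
    Prop :=
  ∃ φ ∈ IsManifold.maximalAtlas 𝓘(ℝ, E) ∞ M, ∃ ψ ∈ IsManifold.maximalAtlas 𝓘(ℝ, E') ∞ N,
    ∃ L : (E × C) ≃L[ℝ] E', x ∈ φ.source ∧ φ.target = univ ∧ φ.source = f ⁻¹' ψ.source ∧
      ∀ y ∈ φ.source, ψ (f y) = L (φ y, 0)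

variable {C : Type*} [NormedAddCommGroup C] [NormedSpace ℝ C] {f : M → N} {x : M}

namespace IsLinearInChartsAt

theorem continuousAt (h : IsLinearInChartsAt E E' C f x) : ContinuousAt f x := by
  obtain ⟨φ, -, ψ, -, L, hx, -, hs, hf⟩ := h
  have h1 : ∀ y ∈ φ.source, f y = ψ.symm (L (φ y, 0)) := fun y hy => by
    rw [← hf y hy, ψ.left_inv (hs.subset hy)]
  have h2 : ContinuousAt (fun y => ψ.symm (L (φ y, 0))) x := by
    refine ContinuousAt.comp (g := ψ.symm) (f := fun y => L (φ y, 0)) ?_ ?_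
    · rw [← hf x hx]
      exact ψ.symm.continuousAt (ψ.map_source (hs.subset hx))
    · exact L.continuous.continuousAt.comp ((φ.continuousAt hx).prodMk continuousAt_const)
  refine h2.congr ?_
  filter_upwards [φ.open_source.mem_nhds hx] with y hy using (h1 y hy).symm

theorem isImmersionAtOfComplement (h : IsLinearInChartsAt E E' C f x) :
    Manifold.IsImmersionAtOfComplement C 𝓘(ℝ, E) 𝓘(ℝ, E') ∞ f x := by
  obtain ⟨φ, hφ, ψ, hψ, L, hx, -, hs, hf⟩ := h
  refine .mk_of_charts L φ ψ hx (hs.subset hx) hφ hψ hs.subset fun a ha => ?_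
  have ha' : a ∈ φ.target := by simpa using ha
  have := hf (φ.symm a) (φ.map_target ha')
  rw [φ.right_inv ha'] at this
  simpa using this

/-- In the charts, project `E × C` onto `E` after `L⁻¹`. The second clause quantifies over all `y :
M`, not only those near `x`, which is possible because the source chart contains every preimage of a
point of the target chart. -/
theorem exists_leftInverse (h : IsLinearInChartsAt E E' C f x) :
    ∃ g : N → M, ContMDiffAt 𝓘(ℝ, E') 𝓘(ℝ, E) ∞ g (f x) ∧
      ∀ᶠ z in nhds (f x), ∀ y, f y = z → g z = y := by
  obtain ⟨φ, hφ, ψ, hψ, L, hx, ht, hs, hf⟩ := h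
  refine ⟨fun z => φ.symm (L.symm (ψ z)).1, ?_, ?_⟩
  · have h1 : ContMDiffAt 𝓘(ℝ, E') 𝓘(ℝ, E') ∞ ψ (f x) :=
      contMDiffAt_of_mem_maximalAtlas hψ (hs.subset hx)
    have h2 : ContMDiff 𝓘(ℝ, E') 𝓘(ℝ, E) ∞ fun b => (L.symm b).1 :=
      (contDiff_fst.comp L.symm.contDiff).contMDiff
    have h3 : ContMDiffAt 𝓘(ℝ, E) 𝓘(ℝ, E) ∞ φ.symm (L.symm (ψ (f x))).1 :=
      contMDiffAt_symm_of_mem_maximalAtlas hφ (ht ▸ mem_univ _)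
    exact ContMDiffAt.comp (g := φ.symm) (f := fun z => (L.symm (ψ z)).1) (f x) h3
      (h2.contMDiffAt.comp (f x) h1)
  · filter_upwards [ψ.open_source.mem_nhds (hs.subset hx)]
    rintro _ hz y rfl
    have hy : y ∈ φ.source := hs.symm.subset hz
    simp [hf y hy, φ.left_inv hy]

/-- By the chain rule, the derivative of the local left inverse is a left inverse of the derivative
of `f`. -/
theorem mfderiv_injective (h : IsLinearInChartsAt E E' C f x) :
    Function.Injective (mfderiv 𝓘(ℝ, E) 𝓘(ℝ, E') f x) := by
  obtain ⟨g, hg, hgf⟩ := h.exists_leftInverse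
  have hf : MDifferentiableAt 𝓘(ℝ, E) 𝓘(ℝ, E') f x :=
    h.isImmersionAtOfComplement.contMDiffAt.mdifferentiableAt (by simp)
  have hg' : MDifferentiableAt 𝓘(ℝ, E') 𝓘(ℝ, E) g (f x) := hg.mdifferentiableAt (by simp)
  have hid : g ∘ f =ᶠ[nhds x] id := by
    filter_upwards [h.continuousAt.eventually hgf] with y hy using hy y rfl
  have hcomp := mfderiv_comp x hg' hf
  rw [hid.mfderiv_eq, mfderiv_id] at hcomp
  refine Function.LeftInverse.injective
    (g := (mfderiv 𝓘(ℝ, E') 𝓘(ℝ, E) g (f x) : E' → E)) fun v => ?_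
  exact (DFunLike.congr_fun hcomp v).symm

theorem isLocalDiffeomorphAt [Subsingleton C] (h : IsLinearInChartsAt E E' C f x) :
    IsLocalDiffeomorphAt 𝓘(ℝ, E) 𝓘(ℝ, E') ∞ f x := by
  obtain ⟨φ, hφ, ψ, hψ, L, hx, ht, hs, hf⟩ := h
  -- Since `C` is trivial, `a ↦ L (a, 0)` is already an isomorphism.
  let L' : E ≃L[ℝ] E' :=
    ContinuousLinearEquiv.equivOfInverse
      ((L : E × C →L[ℝ] E') ∘L ContinuousLinearMap.inl ℝ E C)
      (ContinuousLinearMap.fst ℝ E C ∘L (L.symm : E' →L[ℝ] E × C))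
      (fun a => by simp)
      (fun b => by
        have : ((L.symm b).1, (0 : C)) = L.symm b := Prod.ext rfl (Subsingleton.elim _ _)
        simp [this])
  let Φ := (φ.trans L'.toHomeomorph.toOpenPartialHomeomorph).trans ψ.symm
  have hL1 : ContMDiff 𝓘(ℝ, E) 𝓘(ℝ, E') ∞ L' := L'.contDiff.contMDiff
  have hL2 : ContMDiff 𝓘(ℝ, E') 𝓘(ℝ, E) ∞ L'.symm := L'.symm.contDiff.contMDiff
  have hL : ∀ a, L' a = L (a, 0) := fun a => rfl
  have hΦ : ∀ y ∈ φ.source, f y = Φ y := fun y hy => by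
    change f y = ψ.symm (L' (φ y))
    rw [hL, ← hf y hy, ψ.left_inv (hs.subset hy)]
  have hsrc : ∀ y ∈ Φ.source, y ∈ φ.source ∧ L' (φ y) ∈ ψ.target := fun y hy => by
    simpa [Φ] using hy
  have htgt : ∀ z ∈ Φ.target, z ∈ ψ.source := fun z hz => by
    simp [Φ] at hz
    exact hz.1
  refine ⟨⟨Φ.toPartialEquiv, Φ.open_source, Φ.open_target, ?_, ?_⟩, ?_, fun y hy =>
    hΦ y (hsrc y hy).1⟩
  · exact (contMDiffOn_symm_of_mem_maximalAtlas hψ).comp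
      (hL1.comp_contMDiffOn ((contMDiffOn_of_mem_maximalAtlas hφ).mono fun y hy => (hsrc y hy).1))
      fun y hy => (hsrc y hy).2
  · exact (contMDiffOn_symm_of_mem_maximalAtlas hφ).comp
      (hL2.comp_contMDiffOn ((contMDiffOn_of_mem_maximalAtlas hψ).mono htgt))
      fun y hy => ht.symm.subset (mem_univ _)
  · have : L' (φ x) ∈ ψ.target := by
      rw [hL, ← hf x hx]
      exact ψ.map_source (hs.subset hx)
    change x ∈ Φ.source
    simpa [Φ] using ⟨hx, this⟩

end IsLinearInChartsAt

theorem isSmoothEmbedding_of_isLinearInChartsAt (h : ∀ x, IsLinearInChartsAt E E' C f x) :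
    Manifold.IsSmoothEmbedding 𝓘(ℝ, E) 𝓘(ℝ, E') ∞ f := by
  have himm : Manifold.IsImmersionOfComplement C 𝓘(ℝ, E) 𝓘(ℝ, E') ∞ f :=
    fun x => (h x).isImmersionAtOfComplement
  refine ⟨himm.isImmersion, ⟨⟨?_⟩, fun x y hxy => ?_⟩⟩
  · refine (Topology.isInducing_iff_nhds.2 fun x => le_antisymm ?_ ?_).eq_induced
    · exact (h x).continuousAt.le_comap
    -- If `f y` tends to `f x`, then `y = g (f y)` tends to `g (f x) = x`, by continuity of `g` at
    -- `f x`.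
    · obtain ⟨g, hg, hgf⟩ := (h x).exists_leftInverse
      have hgx : g (f x) = x := hgf.self_of_nhds x rfl
      have h1 : Filter.Tendsto (g ∘ f) (Filter.comap f (nhds (f x))) (nhds x) := by
        have := hg.continuousAt.tendsto.comp (Filter.tendsto_comap (f := f))
        rwa [hgx] at this
      have h2 : g ∘ f =ᶠ[Filter.comap f (nhds (f x))] id := by
        filter_upwards [Filter.tendsto_comap.eventually hgf] with y hy using hy y rfl
      exact h1.congr' h2
  -- At `z = f x` the left-inverse property covers every point of the fibre, so `x` and `y` both
  -- equal `g (f x)`.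
  · obtain ⟨g, -, hgf⟩ := (h x).exists_leftInverse
    exact (hgf.self_of_nhds x rfl).symm.trans (hgf.self_of_nhds y hxy.symm)

end LinearInCharts

/-! ### The charts of the two Grassmannians -/

/-- The chart of `Gr k n` inverse to `Gr.param e`. -/
def Gr.chart {k n : ℕ} (e : Splitting k n) : OpenPartialHomeomorph (Gr k n) (GrModel k n) :=
  (Gr.isSmoothParam k n).core.openPartialHomeomorph
    (chartOf (Gr.param e) ((Gr.isSmoothParam k n).inj e)) (mem_range_self e)

theorem Gr.chart_mem_maximalAtlas {k n : ℕ} (e : Splitting k n) :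
    Gr.chart e ∈ IsManifold.maximalAtlas 𝓘(ℝ, GrModel k n) ∞ (Gr k n) :=
  IsManifold.subset_maximalAtlas
    (mem_iUnion₂.2 ⟨_, mem_range_self e, rfl⟩ : Gr.chart e ∈ atlas (GrModel k n) (Gr k n))

theorem Gr.chart_param {k n : ℕ} (e : Splitting k n) (T : GrModel k n) :
    Gr.chart e (Gr.param e T) = T :=
  Function.leftInverse_invFun ((Gr.isSmoothParam k n).inj e) T

/-- The chart of `Graff k n` inverse to `Graff.param e`. -/
def Graff.chart {k n : ℕ} (e : Splitting k n) :
    OpenPartialHomeomorph (Graff k n) (GraffModel k n) :=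
  (Graff.isSmoothParam k n).core.openPartialHomeomorph
    (chartOf (Graff.param e) ((Graff.isSmoothParam k n).inj e)) (mem_range_self e)

theorem Graff.chart_mem_maximalAtlas {k n : ℕ} (e : Splitting k n) :
    Graff.chart e ∈ IsManifold.maximalAtlas 𝓘(ℝ, GraffModel k n) ∞ (Graff k n) :=
  IsManifold.subset_maximalAtlas
    (mem_iUnion₂.2 ⟨_, mem_range_self e, rfl⟩ :
      Graff.chart e ∈ atlas (GraffModel k n) (Graff k n))

theorem Graff.chart_param {k n : ℕ} (e : Splitting k n) (a : GraffModel k n) :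
    Graff.chart e (Graff.param e a) = a :=
  Function.leftInverse_invFun ((Graff.isSmoothParam k n).inj e) a

/-! ### The decomposition `ℝⁿ⁺¹ = ℝⁿ × ℝ` -/

/-- The isomorphism `ℝⁿ⁺¹ ≃ ℝⁿ × ℝ` that splits off the last coordinate. -/
def splitLast (n : ℕ) : (Fin (n + 1) → ℝ) ≃L[ℝ] (Fin n → ℝ) × ℝ :=
  LinearEquiv.toContinuousLinearEquiv
    { toFun := fun v => (Fin.init v, v (Fin.last n))
      invFun := fun w => Fin.snoc (α := fun _ => ℝ) w.1 w.2
      map_add' := fun _ _ => rfl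
      map_smul' := fun _ _ => rfl
      left_inv := fun v => by simp
      right_inv := fun w => by simp }

theorem splitLast_snd {n : ℕ} (v : Fin (n + 1) → ℝ) : (splitLast n v).2 = v (Fin.last n) := rfl

theorem splitLast_incl {n : ℕ} (w : Fin n → ℝ) : splitLast n (incl n w) = (w, 0) :=
  (splitLast n).apply_symm_apply (w, 0)

theorem splitLast_eLast (n : ℕ) : splitLast n (eLast n) = (0, 1) := by
  refine Prod.ext (funext fun i => ?_) ?_
  · change eLast n i.castSucc = 0
    simp [eLast]
  · simp [splitLast_snd, eLast]

theorem incl_splitLast_fst {n : ℕ} {v : Fin (n + 1) → ℝ} (hv : v (Fin.last n) = 0) :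
    incl n (splitLast n v).1 = v :=
  (splitLast n).injective (by rw [splitLast_incl, ← hv]; rfl)

theorem mem_map_incl {n : ℕ} {A : Submodule ℝ (Fin n → ℝ)} {v : Fin (n + 1) → ℝ} :
    v ∈ A.map (incl n) ↔ (splitLast n v).1 ∈ A ∧ v (Fin.last n) = 0 := by
  constructor
  · rintro ⟨w, hw, rfl⟩
    exact ⟨by rw [splitLast_incl]; exact hw, incl_last w⟩
  · rintro ⟨h1, h2⟩
    exact ⟨_, h1, incl_splitLast_fst h2⟩

/-- The coefficient of `b + eₙ₊₁` in `v` can only be the last coordinate of `v`; what remains after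
subtracting that multiple has height zero and must lie in `A`. -/
theorem mem_liftSpan {n : ℕ} {A : Submodule ℝ (Fin n → ℝ)} {b : Fin n → ℝ}
    {v : Fin (n + 1) → ℝ} :
    v ∈ liftSpan A b ↔ (splitLast n v).1 - v (Fin.last n) • b ∈ A := by
  rw [liftSpan_eq, Submodule.mem_sup]
  constructor
  · rintro ⟨_, ⟨a, ha, rfl⟩, z, hz, rfl⟩
    obtain ⟨t, rfl⟩ := Submodule.mem_span_singleton.1 hz
    have : (splitLast n (incl n a + t • (incl n b + eLast n))).1 -
        (incl n a + t • (incl n b + eLast n)) (Fin.last n) • b = a := by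
      rw [← splitLast_snd (incl n a + _)]
      simp [splitLast_incl, splitLast_eLast]
    rw [this]
    exact ha
  · intro h
    refine ⟨_, ⟨_, h, rfl⟩, _,
      Submodule.mem_span_singleton.2 ⟨v (Fin.last n), rfl⟩, (splitLast n).injective ?_⟩
    refine Prod.ext ?_ ?_
    · simp [splitLast_incl, splitLast_eLast]
    · simp [splitLast_incl, splitLast_eLast, splitLast_snd]

/-! ### The map `j` -/

/-- The flat is recovered from its lift as the slice at height one; this makes `j` injective. -/
theorem incl_add_eLast_mem_j {k n : ℕ} {S : Graff k n} {b : Fin n → ℝ} :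
    incl n b + eLast n ∈ S.j.1 ↔ b ∈ S.1 := by
  obtain ⟨b', hb'⟩ := S.2.1
  rw [S.j_eq hb', mem_liftSpan, ← splitLast_snd (incl n b + _)]
  simpa [splitLast_incl, splitLast_eLast] using AffineSubspace.vsub_right_mem_direction_iff_mem hb' b

theorem j_injective (k n : ℕ) :
    Function.Injective (Graff.j : Graff k n → Gr (k + 1) (n + 1)) := fun S S' h =>
  Subtype.ext (AffineSubspace.ext fun b => by
    rw [← incl_add_eLast_mem_j, h, incl_add_eLast_mem_j])

/-- The complement of the image of `j` consists of the subspaces contained in `ℝⁿ`. -/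
theorem range_j_compl (k n : ℕ) :
    (range (Graff.j : Graff k n → Gr (k + 1) (n + 1)))ᶜ =
      {U | ∀ v ∈ U.1, v (Fin.last n) = 0} := by
  ext U
  rw [mem_compl_iff, not_iff_comm, mem_ofPred_eq]
  push Not
  constructor
  · rintro ⟨v, hv, hv0⟩
    let A : Submodule ℝ (Fin n → ℝ) := U.1.comap (incl n)
    -- Rescale `v` to height one and drop the last coordinate; the direction `A` is the part of `U`
    -- at height zero.
    let b : Fin n → ℝ := (v (Fin.last n))⁻¹ • (splitLast n v).1
    have hb : incl n b + eLast n = (v (Fin.last n))⁻¹ • v := by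
      apply (splitLast n).injective
      refine Prod.ext ?_ ?_
      · simp [b, splitLast_incl, splitLast_eLast]
      · simp [b, splitLast_incl, splitLast_eLast, splitLast_snd, hv0]
    have hU : liftSpan A b = U.1 := by
      refine le_antisymm (Submodule.span_le.2 ?_) fun w hw => ?_
      · rintro _ (⟨a, ha, rfl⟩ | rfl)
        · exact ha
        · rw [hb]
          exact U.1.smul_mem _ hv
      · rw [mem_liftSpan]
        change incl n _ ∈ U.1
        -- Subtracting from `w` its height times the height-one vector of `U` leaves a vector of `U`
        -- at height zero.
        have : incl n ((splitLast n w).1 - w (Fin.last n) • b) =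
            w - w (Fin.last n) • ((v (Fin.last n))⁻¹ • v) := by
          rw [← hb]
          apply (splitLast n).injective
          refine Prod.ext ?_ ?_
          · simp [splitLast_incl, splitLast_eLast]
          · simp [splitLast_incl, splitLast_eLast, splitLast_snd]
        rw [this]
        exact U.1.sub_mem hw (U.1.smul_mem _ (U.1.smul_mem _ hv))
    have hA : finrank ℝ A = k := by
      have := finrank_liftSpan A b
      rw [hU, U.2] at this
      omega
    let S : Graff k n := ⟨AffineSubspace.mk' b A, AffineSubspace.mk'_nonempty b A, by
      rw [AffineSubspace.direction_mk', hA]⟩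
    have hS : S.1.direction = A := AffineSubspace.direction_mk' b A
    exact ⟨S, Subtype.ext (by rw [S.j_eq (AffineSubspace.self_mem_mk' b A), hS, hU])⟩
  · rintro ⟨S, rfl⟩
    obtain ⟨b, hb⟩ := S.2.1
    refine ⟨incl n b + eLast n, ?_, by simp [incl_last, eLast]⟩
    rw [S.j_eq hb]
    exact Submodule.subset_span (Or.inr rfl)

theorem range_incl (k n : ℕ) :
    range (Gr.incl : Gr k n → Gr k (n + 1)) = {U | ∀ v ∈ U.1, v (Fin.last n) = 0} := by
  ext U
  constructor
  · rintro ⟨A, rfl⟩ v hv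
    exact (mem_map_incl.1 hv).2
  · intro h
    have hU : (U.1.comap (incl n)).map (incl n) = U.1 :=
      Submodule.map_comap_eq_of_le fun v hv => ⟨_, incl_splitLast_fst (h v hv)⟩
    refine ⟨⟨U.1.comap (incl n), ?_⟩, Subtype.ext hU⟩
    rw [(Submodule.equivMapOfInjective _ (incl_injective n) _).finrank_eq, hU, U.2]

/-! ### Graph coordinates for `j` and for the inclusion of Grassmannians -/

/-- The isomorphism `(T, c) ↦ ((x, t) ↦ T x + t c)` of spaces of linear maps. -/
def coprodSpanEquiv (F G : Type*) [NormedAddCommGroup F] [NormedSpace ℝ F]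
    [NormedAddCommGroup G] [NormedSpace ℝ G] [FiniteDimensional ℝ F] [FiniteDimensional ℝ G] :
    ((F →L[ℝ] G) × G) ≃L[ℝ] (F × ℝ →L[ℝ] G) :=
  LinearEquiv.toContinuousLinearEquiv
    { toFun := fun a => a.1.coprod (ContinuousLinearMap.toSpanSingleton ℝ a.2)
      invFun := fun A => (A ∘L ContinuousLinearMap.inl ℝ F ℝ, A (0, 1))
      map_add' := fun a b => by
        ext x <;> simp
      map_smul' := fun c a => by
        ext x <;> simp
      left_inv := fun a => by
        refine Prod.ext ?_ ?_
        · ext x; simp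
        · simp
      right_inv := fun A => by
        ext x <;> simp }

theorem coprodSpanEquiv_apply {F G : Type*} [NormedAddCommGroup F] [NormedSpace ℝ F]
    [NormedAddCommGroup G] [NormedSpace ℝ G] [FiniteDimensional ℝ F] [FiniteDimensional ℝ G]
    (a : (F →L[ℝ] G) × G) (x : F × ℝ) : coprodSpanEquiv F G a x = a.1 x.1 + x.2 • a.2 := rfl

/-- Homogenization: with `b = e⁻¹ (0, c)`, the condition `v - t b ∈ graph T` at height `t` reads `y
= T x + t c`. The complement is `PUnit` because this correspondence is bijective on coordinates. -/
theorem Graff.isLinearInChartsAt_j {k n : ℕ} (S : Graff k n) :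
    IsLinearInChartsAt (GraffModel k n) (GrModel (k + 1) (n + 1)) PUnit.{1} Graff.j S := by
  obtain ⟨e, a, ha⟩ := (Graff.isSmoothParam k n).cover S
  let s : ((Fin k → ℝ) × ℝ) ≃L[ℝ] (Fin (k + 1) → ℝ) := (splitLast k).symm
  -- Reconciles the index types, as `n + 1 - (k + 1)` equals `n - k`.
  let c : (Fin (n - k) → ℝ) ≃L[ℝ] (Fin (n + 1 - (k + 1)) → ℝ) :=
    ContinuousLinearEquiv.ofFinrankEq (by simp)
  let r : (((Fin k → ℝ) × (Fin (n - k) → ℝ)) × ℝ) ≃L[ℝ]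
      (((Fin k → ℝ) × ℝ) × (Fin (n - k) → ℝ)) :=
    LinearEquiv.toContinuousLinearEquiv
      { toFun := fun v => ((v.1.1, v.2), v.1.2)
        invFun := fun v => ((v.1.1, v.2), v.1.2)
        map_add' := fun _ _ => rfl
        map_smul' := fun _ _ => rfl
        left_inv := fun _ => rfl
        right_inv := fun _ => rfl }
  let e' : Splitting (k + 1) (n + 1) :=
    (((splitLast n).trans (e.prodCongr (.refl ℝ ℝ))).trans r).trans (s.prodCongr c)
  let Φ : GraffModel k n ≃L[ℝ] GrModel (k + 1) (n + 1) :=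
    (coprodSpanEquiv (Fin k → ℝ) (Fin (n - k) → ℝ)).trans (s.arrowCongr c)
  have key : ∀ a, Graff.j (Graff.param e a) = Gr.param e' (Φ a) := by
    intro a
    refine Subtype.ext ?_
    have hb : e.symm (0, a.2) ∈ (Graff.param e a).1 := by
      change _ ∈ graphAff e a
      simp [mem_graphAff]
    rw [Graff.j_eq _ hb]
    ext v
    rw [mem_liftSpan]
    change _ ∈ (graphAff e a).direction ↔ v ∈ graphSub e' (Φ a)
    rw [graphAff_direction, mem_graphSub, mem_graphSub]
    have h1 : (e' v).2 = c (e (splitLast n v).1).2 := rfl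
    have h2 : Φ a (e' v).1 =
        c (a.1 (e (splitLast n v).1).1 + v (Fin.last n) • a.2) := by
      have : (e' v).1 = s ((e (splitLast n v).1).1, v (Fin.last n)) := rfl
      rw [this]
      change c (coprodSpanEquiv _ _ a (s.symm (s _))) = _
      rw [s.symm_apply_apply, coprodSpanEquiv_apply]
    rw [h1, h2, c.injective.eq_iff]
    simp [sub_eq_iff_eq_add]
  refine ⟨Graff.chart e, Graff.chart_mem_maximalAtlas e, Gr.chart e', Gr.chart_mem_maximalAtlas e',
    (ContinuousLinearEquiv.prodUnique ℝ _ _).trans Φ, ⟨a, ha⟩, rfl, ?_, ?_⟩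
  · ext S'
    constructor
    · rintro ⟨a, rfl⟩
      exact ⟨_, (key a).symm⟩
    · rintro ⟨T, hT⟩
      -- `Φ` is onto, so every graph in the target chart is the lift of a graph in the source chart;
      -- injectivity of `j` then identifies that graph with `S'`.
      refine ⟨Φ.symm T, j_injective k n ?_⟩
      rw [key, Φ.apply_symm_apply, hT]
  · rintro _ ⟨a, rfl⟩
    rw [key, Gr.chart_param]
    erw [Graff.chart_param]
    rfl

/-- The extra coordinate enlarges the codomain of the graph map by a factor `ℝ`, and a subspace of
`ℝⁿ` has zero component there. -/
theorem Gr.isLinearInChartsAt_incl {k n : ℕ} (U : Gr k n) :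
    IsLinearInChartsAt (GrModel k n) (GrModel k (n + 1)) ((Fin k → ℝ) →L[ℝ] ℝ) Gr.incl U := by
  obtain ⟨e, a, ha⟩ := (Gr.isSmoothParam k n).cover U
  have hk : k ≤ n := by
    have := Submodule.finrank_le U.1
    rwa [U.2, finrank_fin_fun] at this
  let c : ((Fin (n - k) → ℝ) × ℝ) ≃L[ℝ] (Fin (n + 1 - k) → ℝ) :=
    ContinuousLinearEquiv.ofFinrankEq (by simp; omega)
  let e' : Splitting k (n + 1) :=
    ((splitLast n).trans (e.prodCongr (.refl ℝ ℝ))).trans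
      ((ContinuousLinearEquiv.prodAssoc ℝ _ _ _).trans ((ContinuousLinearEquiv.refl ℝ _).prodCongr c))
  let Ψ : (GrModel k n × ((Fin k → ℝ) →L[ℝ] ℝ)) ≃L[ℝ] GrModel k (n + 1) :=
    (ContinuousLinearMap.prodₗᵢ ℝ).toContinuousLinearEquiv.trans
      ((ContinuousLinearEquiv.refl ℝ _).arrowCongr c)
  have hmem : ∀ T v, v ∈ (Gr.param e' (Ψ T)).1 ↔
      (e (splitLast n v).1).2 = T.1 (e (splitLast n v).1).1 ∧
        v (Fin.last n) = T.2 (e (splitLast n v).1).1 := by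
    intro T v
    change c ((e (splitLast n v).1).2, v (Fin.last n)) =
      c (T.1 (e (splitLast n v).1).1, T.2 (e (splitLast n v).1).1) ↔ _
    rw [c.injective.eq_iff, Prod.mk.injEq]
  have hincl : ∀ T v, v ∈ (Gr.incl (Gr.param e T)).1 ↔
      (e (splitLast n v).1).2 = T (e (splitLast n v).1).1 ∧ v (Fin.last n) = 0 :=
    fun T v => mem_map_incl
  have key : ∀ T, Gr.incl (Gr.param e T) = Gr.param e' (Ψ (T, 0)) := by
    intro T
    refine Subtype.ext (Submodule.ext fun v => ?_)
    rw [hmem, hincl]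
    rfl
  refine ⟨Gr.chart e, Gr.chart_mem_maximalAtlas e, Gr.chart e', Gr.chart_mem_maximalAtlas e',
    Ψ, ⟨a, ha⟩, rfl, ?_, ?_⟩
  · ext A
    constructor
    · rintro ⟨T, rfl⟩
      exact ⟨_, (key T).symm⟩
    · rintro ⟨T, hT⟩
      refine ⟨(Ψ.symm T).1, Subtype.ext (Submodule.ext fun w => ?_)⟩
      have h1 : ∀ v, v ∈ (Gr.incl A).1 ↔
          (e (splitLast n v).1).2 = (Ψ.symm T).1 (e (splitLast n v).1).1 ∧
            v (Fin.last n) = (Ψ.symm T).2 (e (splitLast n v).1).1 := fun v => by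
        rw [← hmem, Ψ.apply_symm_apply, hT]
      -- The point of the graph over `x` lies in `ℝⁿ`, and its last coordinate is this value.
      have h0 : ∀ x, (Ψ.symm T).2 x = 0 := fun x => by
        have h2 := (h1 ((splitLast n).symm (e.symm (x, (Ψ.symm T).1 x), (Ψ.symm T).2 x))).2
          (by simp [← splitLast_snd])
        have h3 := (mem_map_incl.1 h2).2
        simpa [← splitLast_snd] using h3
      have h2 := h1 (AffGr.incl n w)
      simp only [splitLast_incl, h0, incl_last, and_true] at h2
      refine Iff.trans h2.symm ((mem_map_incl (A := A.1)).trans ?_)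
      simp [splitLast_incl, incl_last]
  · rintro _ ⟨T, rfl⟩
    rw [key, Gr.chart_param]
    erw [Gr.chart_param]

/-- The differential is injective, so the codimension is `k (n + 1 - k) - k (n - k)`. A point `U`
forces `k ≤ n`, so the truncated subtractions are genuine. -/
theorem Gr.finrank_quotient_range_mfderiv_incl {k n : ℕ} (U : Gr k n) :
    finrank ℝ (TangentSpace 𝓘(ℝ, GrModel k (n + 1)) U.incl ⧸
      (mfderiv 𝓘(ℝ, GrModel k n) 𝓘(ℝ, GrModel k (n + 1)) Gr.incl U).range) = k := by
  have hk : k ≤ n := by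
    have := Submodule.finrank_le U.1
    rwa [U.2, finrank_fin_fun] at this
  have hdim : ∀ m, finrank ℝ (GrModel k m) = k * (m - k) := fun m => by
    rw [← (LinearMap.toContinuousLinearMap (𝕜 := ℝ) (E := Fin k → ℝ)
      (F' := Fin (m - k) → ℝ)).finrank_eq, finrank_linearMap, finrank_fin_fun, finrank_fin_fun]
  let D : GrModel k n →L[ℝ] GrModel k (n + 1) :=
    mfderiv 𝓘(ℝ, GrModel k n) 𝓘(ℝ, GrModel k (n + 1)) Gr.incl U
  have hD : Function.Injective D := (Gr.isLinearInChartsAt_incl U).mfderiv_injective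
  change finrank ℝ (GrModel k (n + 1) ⧸ LinearMap.range D.toLinearMap) = k
  have h1 := Submodule.finrank_quotient_add_finrank (LinearMap.range D.toLinearMap)
  have h2 : n + 1 - k = n - k + 1 := by omega
  rw [LinearMap.finrank_range_of_inj hD, hdim, hdim] at h1
  have h3 : k * (n + 1 - k) = k * (n - k) + k := by rw [h2, mul_add, mul_one]
  omega

/-! ### The invariant measure of a great subsphere -/

open MeasureTheory

/-- Every nonzero vector is, up to normalization, a row of an orthogonal matrix. -/
theorem exists_orthogonal_row {n : ℕ} (i : Fin n) {w : Fin n → ℝ} (hw : w ≠ 0) :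
    ∃ (A : Matrix.orthogonalGroup (Fin n) ℝ) (r : ℝ), r ≠ 0 ∧ ∀ j, A.1 i j = r * w j := by
  let u : EuclideanSpace ℝ (Fin n) := WithLp.toLp 2 w
  have hu : ‖u‖ ≠ 0 := by simpa [u] using hw
  have hon : Orthonormal ℝ (({i} : Set (Fin n)).domRestrict fun _ => ‖u‖⁻¹ • u) := by
    refine ⟨fun _ => ?_, fun a b hab => (hab (Subsingleton.elim a b)).elim⟩
    change ‖‖u‖⁻¹ • u‖ = 1
    simp [norm_smul, hu]
  obtain ⟨b, hb⟩ := hon.exists_orthonormalBasis_extension_of_card_eq (by simp)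
  refine ⟨⟨Matrix.of fun i j => b i j, ?_⟩, ‖u‖⁻¹, inv_ne_zero hu, fun j => ?_⟩
  · rw [Matrix.mem_orthogonalGroup_iff]
    ext a c
    have h := orthonormal_iff_ite.1 b.orthonormal a c
    rw [Matrix.mul_apply, Matrix.one_apply, ← h, PiLp.inner_apply]
    simp [mul_comm]
  · have := hb i rfl
    simp [this, u]

/-- A given matrix entry vanishes only on a null set of orthogonal matrices. -/
theorem haarMeasure_entry_eq_zero {n : ℕ} (i j : Fin n) :
    Measure.haarMeasure (⊤ : TopologicalSpace.PositiveCompacts (Matrix.orthogonalGroup (Fin n) ℝ))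
      {g | g.1 i j = 0} = 0 := by
  set μ := Measure.haarMeasure
    (⊤ : TopologicalSpace.PositiveCompacts (Matrix.orthogonalGroup (Fin n) ℝ))
  have : IsProbabilityMeasure μ := ⟨Measure.haarMeasure_self⟩
  -- The pairing of column `j` of `g` with the vector `(1, t, t², …)` on the moment curve.
  let D (t : ℝ) (g : Matrix.orthogonalGroup (Fin n) ℝ) : ℝ := ∑ l : Fin n, t ^ (l : ℕ) * g.1 l j
  have hpos : 0 < n := i.pos
  have hμ : ∀ t, μ {g | D t g = 0} = μ {g | g.1 i j = 0} := by
    intro t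
    -- The entry at index `0` is `t ^ 0 = 1`, also for `t = 0`.
    have hw : (fun l : Fin n => t ^ (l : ℕ)) ≠ 0 := fun h => by
      simpa using congrFun h ⟨0, hpos⟩
    obtain ⟨A, r, hr, hA⟩ := exists_orthogonal_row i hw
    -- Left translation by `A` turns entry `(i, j)` of `g` into a nonzero multiple of `D t g`.
    rw [← measure_preimage_mul μ A {g | g.1 i j = 0}]
    congr 1
    ext g
    change D t g = 0 ↔ (A.1 * g.1) i j = 0
    have : (A.1 * g.1) i j = r * D t g := by
      simp [Matrix.mul_apply, hA, D, Finset.mul_sum, mul_assoc]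
    rw [this, mul_eq_zero, or_iff_right hr]
  -- For fixed `g` this is a polynomial in `t`, nonzero because a column of an orthogonal matrix is
  -- nonzero.
  have hfin : ∀ g, {t | D t g = 0}.Finite := by
    intro g
    let P : Polynomial ℝ := ∑ l : Fin n, Polynomial.C (g.1 l j) * Polynomial.X ^ (l : ℕ)
    have hP : P ≠ 0 := fun h => by
      have hcol : ∀ l, g.1 l j = 0 := fun l => by
        have := congrArg (fun Q => Q.coeff (l : ℕ)) h
        simpa [P, Polynomial.finsetSum_coeff, Polynomial.coeff_C_mul, Polynomial.coeff_X_pow,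
          Fin.val_inj] using this
      have h1 := congrFun (congrFun ((Matrix.mem_orthogonalGroup_iff' _ _).1 g.2) j) j
      simp [Matrix.mul_apply, hcol] at h1
    refine (P.roots.toFinset.finite_toSet).subset fun t ht => ?_
    have : P.eval t = D t g := by
      simp only [P, Polynomial.eval_finsetSum]
      exact Finset.sum_congr rfl fun l _ => by
        rw [Polynomial.eval_C_mul, Polynomial.eval_X_pow, mul_comm]
    simp [hP, this, ht.out]
  have hcont : Continuous fun x : Matrix.orthogonalGroup (Fin n) ℝ × ℝ => D x.2 x.1 := by
    refine continuous_finsetSum _ fun l _ => (continuous_snd.pow _).mul ?_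
    exact (continuous_subtype_val.comp continuous_fst).matrix_elem l j
  have hmeas : MeasurableSet {x : Matrix.orthogonalGroup (Fin n) ℝ × ℝ | D x.2 x.1 = 0} :=
    (isClosed_eq hcont continuous_const).measurableSet
  have hnull : (μ.prod (volume : Measure ℝ)) {x | D x.2 x.1 = 0} = 0 := by
    rw [Measure.measure_prod_null hmeas]
    exact Filter.Eventually.of_forall fun g => (hfin g).measure_zero _
  -- Integrating in the other order, `{g | D t g = 0}` is null for almost every `t`; a single such
  -- `t` suffices, since the measure does not depend on `t`.
  rw [← Measure.prod_swap, Measure.map_apply measurable_swap hmeas,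
    Measure.measure_prod_null (measurable_swap hmeas)] at hnull
  obtain ⟨t, ht⟩ := hnull.exists
  rw [← hμ t]
  exact ht

/-- The first basis vector lies in the base plane, and its image under `g` is the first column of
`g`; if `g ℝᵏ⁺¹ ⊆ ℝⁿ`, the last entry of that column vanishes. -/
theorem Gr.measure_last_eq_zero {k n : ℕ} (h : k + 1 ≤ n + 1)
    (hm : MeasurableSet {U : Gr (k + 1) (n + 1) | ∀ v ∈ U.1, v (Fin.last n) = 0}) :
    Gr.measure h {U | ∀ v ∈ U.1, v (Fin.last n) = 0} = 0 := by
  rw [Gr.measure, Measure.map_apply (Gr.continuous_act (Gr.base h)).measurable hm]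
  refine measure_mono_null ?_ (haarMeasure_entry_eq_zero (Fin.last n) 0)
  intro g hg
  have h1 := hg _ (Submodule.mem_map_of_mem (Submodule.subset_span (mem_range_self 0)))
  simpa using h1

end AffGr

end

theorem mainTheorem1 (n k : ℕ) (hn : 2 ≤ n) (hk : 1 ≤ k) (hkn : k ≤ n) :
    -- `j (A + b) = span (A ∪ {b + eₙ₊₁})` for every displacement vector `b`
    (∀ (S : AffGr.Graff k n) (b : Fin n → ℝ), b ∈ S.1 →
      S.j.1 = Submodule.span ℝ
        (AffGr.incl n '' (S.1.direction : Set (Fin n → ℝ)) ∪ {AffGr.incl n b + AffGr.eLast n})) ∧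
    -- `j` is a smooth embedding with open image, and a diffeomorphism onto it
    Manifold.IsSmoothEmbedding 𝓘(ℝ, AffGr.GraffModel k n)
      𝓘(ℝ, AffGr.GrModel (k + 1) (n + 1)) ∞
      (AffGr.Graff.j : AffGr.Graff k n → AffGr.Gr (k + 1) (n + 1)) ∧
    IsLocalDiffeomorph 𝓘(ℝ, AffGr.GraffModel k n) 𝓘(ℝ, AffGr.GrModel (k + 1) (n + 1)) ∞
      (AffGr.Graff.j : AffGr.Graff k n → AffGr.Gr (k + 1) (n + 1)) ∧
    IsOpen (range (AffGr.Graff.j : AffGr.Graff k n → AffGr.Gr (k + 1) (n + 1))) ∧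
    -- the complement of the image is the copy of `Gr(k + 1, n)` embedded by `ℝⁿ ⊆ ℝⁿ⁺¹`
    Manifold.IsSmoothEmbedding 𝓘(ℝ, AffGr.GrModel (k + 1) n)
      𝓘(ℝ, AffGr.GrModel (k + 1) (n + 1)) ∞
      (AffGr.Gr.incl : AffGr.Gr (k + 1) n → AffGr.Gr (k + 1) (n + 1)) ∧
    (range (AffGr.Graff.j : AffGr.Graff k n → AffGr.Gr (k + 1) (n + 1)))ᶜ =
      range (AffGr.Gr.incl : AffGr.Gr (k + 1) n → AffGr.Gr (k + 1) (n + 1)) ∧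
    -- the complement has codimension `k + 1 ≥ 2` at each of its points
    (∀ U : AffGr.Gr (k + 1) n,
      finrank ℝ (TangentSpace 𝓘(ℝ, AffGr.GrModel (k + 1) (n + 1)) U.incl ⧸
        (mfderiv 𝓘(ℝ, AffGr.GrModel (k + 1) n) 𝓘(ℝ, AffGr.GrModel (k + 1) (n + 1))
          AffGr.Gr.incl U).range) = k + 1) ∧
    2 ≤ k + 1 ∧
    -- the complement has measure zero
    AffGr.Gr.measure (Nat.succ_le_succ hkn)
      (range (AffGr.Graff.j : AffGr.Graff k n → AffGr.Gr (k + 1) (n + 1)))ᶜ = 0 := by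
  have hj := fun S : AffGr.Graff k n => S.isLinearInChartsAt_j
  have hi := fun U : AffGr.Gr (k + 1) n => U.isLinearInChartsAt_incl
  have hjdiff : IsLocalDiffeomorph 𝓘(ℝ, AffGr.GraffModel k n) 𝓘(ℝ, AffGr.GrModel (k + 1) (n + 1)) ∞
      (AffGr.Graff.j : AffGr.Graff k n → AffGr.Gr (k + 1) (n + 1)) :=
    fun S => (hj S).isLocalDiffeomorphAt
  refine ⟨fun S b hb => S.j_eq hb, AffGr.isSmoothEmbedding_of_isLinearInChartsAt hj, hjdiff,
    hjdiff.isOpen_range, AffGr.isSmoothEmbedding_of_isLinearInChartsAt hi,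
    (AffGr.range_j_compl k n).trans (AffGr.range_incl (k + 1) n).symm,
    fun U => U.finrank_quotient_range_mfderiv_incl, by omega, ?_⟩
  -- The set is measurable as the complement of the open image of `j`.
  have hm := hjdiff.isOpen_range.measurableSet.compl
  rw [AffGr.range_j_compl] at hm ⊢
  exact AffGr.Gr.measure_last_eq_zero _ hm
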